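/- Write $\rightsquigarrow$ for strict implication. Fix a set $\mathrm{Prop}$ of propositional atoms and let $\mathcal{L}$ be the set of formulas $\varphi ::= p \mid \top \mid \bot \mid \varphi\wedge\varphi \mid \varphi\vee\varphi \mid \varphi\to\varphi \mid \varphi\rightsquigarrow \varphi$ with $p\in\mathrm{Prop}$. An \emph{$\mathsf{iA}$-logic} is a set $\Lambda\subseteq\mathcal{L}$ that contains all axioms of intuitionistic propositional calculus (for all formulas of $\mathcal{L}$) and all formulas $((\varphi\rightsquigarrow \psi)\wedge(\varphi\rightsquigarrow \chi))\to(\varphi\rightsquigarrow (\psi\wedge\chi))$, $((\varphi\rightsquigarrow \chi)\wedge(\psi\rightsquigarrow \chi))\to((\varphi\vee\psi)\rightsquigarrow \chi)$, $((\varphi\rightsquigarrow \psi)\wedge(\psi\rightsquigarrow \chi))\to(\varphi\rightsquigarrow \chi)$, and is closed under modus ponens, uniform substitution and arrow necessitation (if $\varphi\to\psi\in\Lambda$ then $\varphi\rightsquigarrow \psi\in\Lambda$). A \emph{general $\rightsquigarrow $-frame} is a tuple $(X,\preceq,\sqsubset,P)$ where $(X,\preceq)$ is a (possibly empty) poset,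 $\sqsubset$ is a binary relation on $X$ such that $x\preceq y\sqsubset z$ implies $x\sqsubset z$, and $P$ is a collection of upsets of $(X,\preceq)$ that contains $X$ and $\emptyset$ and is closed under $\cap$, $\cup$ and the operations $a\Rightarrow b=\{x \mid \forall y\,(x\preceq y\text{ and }y\in a\text{ imply }y\in b)\}$ and $a\rightarrowtail b=\{x \mid \forall y\,(x\sqsubset y\text{ and }y\in a\text{ imply }y\in b)\}$. It is \emph{descriptive} if moreover (i) for all $A\subseteq P$ and $B\subseteq\{X\setminus a\mid a\in P\}$, if every finite subfamily of $A\cup B$ has non-empty intersection (the empty family having intersection $X$), then $\bigcap(A\cup B)\neq\emptyset$; (ii) if $x\not\preceq y$ then there is $a\in P$ with $x\in a$ and $y\notin a$; (iii) if $x\not\sqsubset y$ then there are $a,b\in P$ with $x\in a\rightarrowtail b$, $y\in a$ and $y\notin b$. A formula $\varphi$ is \emph{valid} in a general $\rightsquigarrow $-frame if for every map $V:\mathrm{Prop}\to P$ the truth set of $\varphi$ is $X$, where truth sets are computed from $V$ by interpreting $\top,\bot,\wedge,\vee,\to,\rightsquigarrow $ as $X,\emptyset,\cap,\cup,\Rightarrow,\rightarrowtail$.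 \textbf{Theorem.} Every $\mathsf{iA}$-logic $\Lambda$ is characterised by a class of descriptive $\rightsquigarrow $-frames: there is a class $\mathcal{C}$ of descriptive $\rightsquigarrow $-frames such that for every formula $\varphi\in\mathcal{L}$, $\varphi\in\Lambda$ if and only if $\varphi$ is valid in every frame in $\mathcal{C}$. -/

import Mathlib

universe u v

namespace HeytingLewis

/-- Formulas of the language with strict implication over a set of propositional atoms.
`imp` is intuitionistic implication and `sto` is strict implication. -/
inductive Formula (Atom : Type u) : Type u
  | atom : Atom → Formula Atom
  | top : Formula Atom
  | bot : Formula Atom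
  | and : Formula Atom → Formula Atom → Formula Atom
  | or : Formula Atom → Formula Atom → Formula Atom
  | imp : Formula Atom → Formula Atom → Formula Atom
  | sto : Formula Atom → Formula Atom → Formula Atom

/-- Simultaneous substitution of formulas for atoms. -/
def Formula.subst {Atom : Type u} (s : Atom → Formula Atom) : Formula Atom → Formula Atom
  | .atom p => s p
  | .top => .top
  | .bot => .bot
  | .and φ ψ => .and (φ.subst s) (ψ.subst s)
  | .or φ ψ => .or (φ.subst s) (ψ.subst s)
  | .imp φ ψ => .imp (φ.subst s) (ψ.subst s)
  | .sto φ ψ => .sto (φ.subst s) (ψ.subst s)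

/-- A standard Hilbert axiomatisation of the intuitionistic propositional calculus
(its only rule is modus ponens). -/
inductive IPCAxiom {Atom : Type u} : Formula Atom → Prop
  | k (φ ψ : Formula Atom) : IPCAxiom (.imp φ (.imp ψ φ))
  | s (φ ψ χ : Formula Atom) :
      IPCAxiom (.imp (.imp φ (.imp ψ χ)) (.imp (.imp φ ψ) (.imp φ χ)))
  | andLeft (φ ψ : Formula Atom) : IPCAxiom (.imp (.and φ ψ) φ)
  | andRight (φ ψ : Formula Atom) : IPCAxiom (.imp (.and φ ψ) ψ)
  | andIntro (φ ψ : Formula Atom) : IPCAxiom (.imp φ (.imp ψ (.and φ ψ)))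
  | orLeft (φ ψ : Formula Atom) : IPCAxiom (.imp φ (.or φ ψ))
  | orRight (φ ψ : Formula Atom) : IPCAxiom (.imp ψ (.or φ ψ))
  | orElim (φ ψ χ : Formula Atom) :
      IPCAxiom (.imp (.imp φ χ) (.imp (.imp ψ χ) (.imp (.or φ ψ) χ)))
  | exFalso (φ : Formula Atom) : IPCAxiom (.imp .bot φ)
  | top : IPCAxiom .top

/-- The axioms of `iA` for strict implication. -/
inductive ArrowAxiom {Atom : Type u} : Formula Atom → Prop
  | ka (φ ψ χ : Formula Atom) :
      ArrowAxiom (.imp (.and (.sto φ ψ) (.sto φ χ)) (.sto φ (.and ψ χ)))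
  | di (φ ψ χ : Formula Atom) :
      ArrowAxiom (.imp (.and (.sto φ χ) (.sto ψ χ)) (.sto (.or φ ψ) χ))
  | tr (φ ψ χ : Formula Atom) :
      ArrowAxiom (.imp (.and (.sto φ ψ) (.sto ψ χ)) (.sto φ χ))

/-- An `iA`-logic. -/
structure IsLogic {Atom : Type u} (L : Set (Formula Atom)) : Prop where
  ipc : ∀ φ, IPCAxiom φ → φ ∈ L
  arrow : ∀ φ, ArrowAxiom φ → φ ∈ L
  modusPonens : ∀ φ ψ, Formula.imp φ ψ ∈ L → φ ∈ L → ψ ∈ L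
  arrowNecessitation : ∀ φ ψ, Formula.imp φ ψ ∈ L → Formula.sto φ ψ ∈ L
  substitution : ∀ (s : Atom → Formula Atom) (φ), φ ∈ L → φ.subst s ∈ L

/-- A strict implication frame: a poset with a compatible binary relation `r`. -/
structure StoFrame : Type (v + 1) where
  X : Type v
  [order : PartialOrder X]
  r : X → X → Prop
  r_of_le_of_r : ∀ x y z : X, x ≤ y → r y z → r x z

attribute [instance] StoFrame.order

namespace StoFrame

/-- Interpretation of intuitionistic implication. -/
def impSet (F : StoFrame.{v}) (a b : Set F.X) : Set F.X :=
  {x | ∀ y, x ≤ y → y ∈ a → y ∈ b}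

/-- Interpretation of strict implication. -/
def stoSet (F : StoFrame.{v}) (a b : Set F.X) : Set F.X :=
  {x | ∀ y, F.r x y → y ∈ a → y ∈ b}

/-- The truth set of a formula under a valuation of the atoms. -/
def truthSet (F : StoFrame.{v}) {Atom : Type u} (V : Atom → Set F.X) :
    Formula Atom → Set F.X
  | .atom p => V p
  | .top => Set.univ
  | .bot => ∅
  | .and φ ψ => F.truthSet V φ ∩ F.truthSet V ψ
  | .or φ ψ => F.truthSet V φ ∪ F.truthSet V ψ
  | .imp φ ψ => F.impSet (F.truthSet V φ) (F.truthSet V ψ)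
  | .sto φ ψ => F.stoSet (F.truthSet V φ) (F.truthSet V ψ)

end StoFrame

/-- A general strict implication frame: a strict implication frame with a collection `P`
of admissible upsets. -/
structure GeneralFrame : Type (v + 1) extends StoFrame.{v} where
  P : Set (Set X)
  isUpperSet : ∀ a ∈ P, IsUpperSet a
  univ_mem : Set.univ ∈ P
  empty_mem : ∅ ∈ P
  inter_mem : ∀ a ∈ P, ∀ b ∈ P, a ∩ b ∈ P
  union_mem : ∀ a ∈ P, ∀ b ∈ P, a ∪ b ∈ P
  imp_mem : ∀ a ∈ P, ∀ b ∈ P, toStoFrame.impSet a b ∈ P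
  sto_mem : ∀ a ∈ P, ∀ b ∈ P, toStoFrame.stoSet a b ∈ P

/-- The finite intersection property; the intersection of the empty family is the whole set. -/
def FiniteInter {X : Type v} (S : Set (Set X)) : Prop :=
  ∀ T ⊆ S, T.Finite → (⋂₀ T).Nonempty

namespace GeneralFrame

/-- Validity in a general frame: truth at all points under all admissible valuations. -/
def Validates (G : GeneralFrame.{v}) {Atom : Type u} (φ : Formula Atom) : Prop :=
  ∀ V : Atom → Set G.X, (∀ p, V p ∈ G.P) → G.truthSet V φ = Set.univ

/-- Descriptive general frames. -/
structure IsDescriptive (G : GeneralFrame.{v}) : Prop where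
  compact : ∀ A B : Set (Set G.X), A ⊆ G.P → B ⊆ {c | ∃ a ∈ G.P, c = aᶜ} →
    FiniteInter (A ∪ B) → (⋂₀ (A ∪ B)).Nonempty
  leRefined : ∀ x y : G.X, ¬ x ≤ y → ∃ a ∈ G.P, x ∈ a ∧ y ∉ a
  rRefined : ∀ x y : G.X, ¬ G.r x y →
    ∃ a ∈ G.P, ∃ b ∈ G.P, x ∈ G.stoSet a b ∧ y ∈ a ∧ y ∉ b

end GeneralFrame

/-- `L` is characterised by the class `C` of general frames: `L` is sound and complete
with respect to `C`. -/
def IsCharacterisedBy {Atom : Type u} (L : Set (Formula Atom))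
    (C : Set GeneralFrame.{v}) : Prop :=
  ∀ φ : Formula Atom, φ ∈ L ↔ ∀ G ∈ C, G.Validates φ

end HeytingLewis

/-! A single canonical frame suffices. Its points are the prime theories containing `L`, ordered by
inclusion; `x` sees `y` when `y` is closed under the strict implications in `x`; the admissible sets
are the sets `hat L φ`. Everything rests on one prime filter theorem,
`IsEntailment.exists_isPrimeTheory`, stated for an abstract entailment relation and used with three
of them. Implication inside a theory gives the truth lemma for `imp` and completeness. Strict
implication inside a theory gives the truth lemma for `sto`. Inclusion of truth sets relative to
finitely many members of a family gives compactness. The two refinement conditions unfold from the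
definitions of the order and of `r`. -/

namespace HeytingLewis

open Formula

variable {Atom : Type u}

/-! ### Derived rules of intuitionistic propositional calculus -/

/-- A set of formulas containing the intuitionistic axioms and closed under modus ponens. -/
structure IsTheory (T : Set (Formula Atom)) : Prop where
  ipc : ∀ φ, IPCAxiom φ → φ ∈ T
  mp : ∀ {φ ψ}, imp φ ψ ∈ T → φ ∈ T → ψ ∈ T

theorem IsLogic.isTheory {L : Set (Formula Atom)} (hL : IsLogic L) : IsTheory L :=
  ⟨hL.ipc, fun {φ ψ} h => hL.modusPonens φ ψ h⟩

namespace IsTheory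

variable {T : Set (Formula Atom)}

theorem imp_of_mem (hT : IsTheory T) {φ ψ : Formula Atom} (h : ψ ∈ T) : imp φ ψ ∈ T :=
  hT.mp (hT.ipc _ (.k ψ φ)) h

theorem imp_mp (hT : IsTheory T) {φ ψ χ : Formula Atom} (h : imp φ (imp ψ χ) ∈ T)
    (h' : imp φ ψ ∈ T) : imp φ χ ∈ T :=
  hT.mp (hT.mp (hT.ipc _ (.s φ ψ χ)) h) h'

theorem imp_refl (hT : IsTheory T) (φ : Formula Atom) : imp φ φ ∈ T :=
  hT.imp_mp (hT.ipc _ (.k φ (imp φ φ))) (hT.ipc _ (.k φ φ))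

theorem imp_trans (hT : IsTheory T) {φ ψ χ : Formula Atom} (h : imp φ ψ ∈ T)
    (h' : imp ψ χ ∈ T) : imp φ χ ∈ T :=
  hT.imp_mp (hT.imp_of_mem h') h

theorem and_mem (hT : IsTheory T) {φ ψ : Formula Atom} (h : φ ∈ T) (h' : ψ ∈ T) :
    Formula.and φ ψ ∈ T :=
  hT.mp (hT.mp (hT.ipc _ (.andIntro φ ψ)) h) h'

theorem and_left (hT : IsTheory T) {φ ψ : Formula Atom} (h : Formula.and φ ψ ∈ T) : φ ∈ T :=
  hT.mp (hT.ipc _ (.andLeft φ ψ)) h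

theorem and_right (hT : IsTheory T) {φ ψ : Formula Atom} (h : Formula.and φ ψ ∈ T) : ψ ∈ T :=
  hT.mp (hT.ipc _ (.andRight φ ψ)) h

theorem imp_and (hT : IsTheory T) {φ ψ χ : Formula Atom} (h : imp φ ψ ∈ T)
    (h' : imp φ χ ∈ T) : imp φ (Formula.and ψ χ) ∈ T :=
  hT.imp_mp (hT.imp_trans h (hT.ipc _ (.andIntro ψ χ))) h'

theorem or_imp (hT : IsTheory T) {φ ψ χ : Formula Atom} (h : imp φ χ ∈ T)
    (h' : imp ψ χ ∈ T) : imp (Formula.or φ ψ) χ ∈ T :=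
  hT.mp (hT.mp (hT.ipc _ (.orElim φ ψ χ)) h) h'

theorem imp_curry (hT : IsTheory T) {φ ψ χ : Formula Atom} (h : imp (Formula.and φ ψ) χ ∈ T) :
    imp φ (imp ψ χ) ∈ T :=
  hT.imp_trans (hT.ipc _ (.andIntro φ ψ))
    (hT.mp (hT.ipc _ (.s ψ (Formula.and φ ψ) χ)) (hT.imp_of_mem h))

theorem imp_swap (hT : IsTheory T) {φ ψ χ : Formula Atom} (h : imp φ (imp ψ χ) ∈ T) :
    imp ψ (imp φ χ) ∈ T :=
  hT.imp_trans (hT.ipc _ (.k ψ φ)) (hT.mp (hT.ipc _ (.s φ ψ χ)) h)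

theorem and_or_distrib (hT : IsTheory T) (φ ψ χ : Formula Atom) :
    imp (Formula.and φ (Formula.or ψ χ)) (Formula.or (Formula.and φ ψ) (Formula.and φ χ)) ∈ T := by
  have h₁ := hT.imp_swap (hT.imp_curry (hT.ipc _ (.orLeft (Formula.and φ ψ) (Formula.and φ χ))))
  have h₂ := hT.imp_swap (hT.imp_curry (hT.ipc _ (.orRight (Formula.and φ ψ) (Formula.and φ χ))))
  exact hT.imp_mp (hT.imp_trans (hT.ipc _ (.andRight φ (Formula.or ψ χ))) (hT.or_imp h₁ h₂))
    (hT.ipc _ (.andLeft φ (Formula.or ψ χ)))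

end IsTheory

/-! ### Entailment relations and prime theories -/

/-- A transitive relation extending provable implication in `L` that respects meets on the
right and joins on the left. -/
structure IsEntailment (L : Set (Formula Atom)) (R : Formula Atom → Formula Atom → Prop) :
    Prop where
  of_imp : ∀ {φ ψ}, imp φ ψ ∈ L → R φ ψ
  trans : ∀ {φ ψ χ}, R φ ψ → R ψ χ → R φ χ
  and : ∀ {φ ψ χ}, R φ ψ → R φ χ → R φ (Formula.and ψ χ)
  or : ∀ {φ ψ χ}, R φ χ → R ψ χ → R (Formula.or φ ψ) χ

/-- A prime theory extending `L`. -/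
structure IsPrimeTheory (L G : Set (Formula Atom)) : Prop where
  subset : L ⊆ G
  mp : ∀ {φ ψ}, imp φ ψ ∈ G → φ ∈ G → ψ ∈ G
  bot_notMem : bot ∉ G
  mem_or_mem : ∀ {φ ψ}, Formula.or φ ψ ∈ G → φ ∈ G ∨ ψ ∈ G

theorem IsPrimeTheory.isTheory {L G : Set (Formula Atom)} (hL : IsTheory L)
    (hG : IsPrimeTheory L G) : IsTheory G :=
  ⟨fun φ h => hG.subset (hL.ipc φ h), hG.mp⟩

/-- The filters of an entailment relation that contain `α` and omit `β`. -/
structure IsSeparatingFilter (R : Formula Atom → Formula Atom → Prop) (α β : Formula Atom)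
    (G : Set (Formula Atom)) : Prop where
  mem : α ∈ G
  notMem : β ∉ G
  up : ∀ {φ ψ}, R φ ψ → φ ∈ G → ψ ∈ G
  and_mem : ∀ {φ ψ}, φ ∈ G → ψ ∈ G → Formula.and φ ψ ∈ G

section PrimeExtension

variable {L : Set (Formula Atom)} {R : Formula Atom → Formula Atom → Prop} {α β : Formula Atom}

theorem IsSeparatingFilter.exists_maximal (hL : IsTheory L) (hR : IsEntailment L R)
    (h : ¬ R α β) : ∃ G, Maximal (IsSeparatingFilter R α β) G := by
  -- Zorn's lemma starts from the principal filter of `α`.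
  have h₀ : IsSeparatingFilter R α β {φ | R α φ} :=
    ⟨hR.of_imp (hL.imp_refl α), h, fun h₁ h₂ => hR.trans h₂ h₁, fun h₁ h₂ => hR.and h₁ h₂⟩
  have hchain : ∀ c ⊆ {G | IsSeparatingFilter R α β G}, IsChain (· ⊆ ·) c → c.Nonempty →
      ∃ ub ∈ {G | IsSeparatingFilter R α β G}, ∀ s ∈ c, s ⊆ ub := by
    rintro c hc hchain ⟨s, hs⟩
    refine ⟨⋃₀ c, ⟨⟨s, hs, (hc hs).mem⟩, ?_, ?_, ?_⟩, fun s hs => Set.subset_sUnion_of_mem hs⟩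
    · rintro ⟨t, ht, hβ⟩
      exact (hc ht).notMem hβ
    · rintro φ ψ hφψ ⟨t, ht, hφ⟩
      exact ⟨t, ht, (hc ht).up hφψ hφ⟩
    · rintro φ ψ ⟨t, ht, hφ⟩ ⟨t', ht', hψ⟩
      rcases hchain.total ht ht' with hle | hle
      · exact ⟨t', ht', (hc ht').and_mem (hle hφ) hψ⟩
      · exact ⟨t, ht, (hc ht).and_mem hφ (hle hψ)⟩
  obtain ⟨G, -, hG⟩ := zorn_subset_nonempty _ hchain _ h₀
  exact ⟨G, hG⟩

/-- Otherwise the filter generated by `G` and `φ` would still omit `β`, and maximality would put `φ`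
in `G`. -/
theorem IsSeparatingFilter.exists_and_entails_of_maximal (hL : IsTheory L)
    (hR : IsEntailment L R) {G : Set (Formula Atom)} (hG : Maximal (IsSeparatingFilter R α β) G)
    {φ : Formula Atom} (hφ : φ ∉ G) : ∃ γ ∈ G, R (Formula.and γ φ) β := by
  by_contra! hcon
  have hsub : G ⊆ {ψ | ∃ γ ∈ G, R (Formula.and γ φ) ψ} := fun γ hγ =>
    ⟨γ, hγ, hR.of_imp (hL.ipc _ (.andLeft γ φ))⟩
  have hfil : IsSeparatingFilter R α β {ψ | ∃ γ ∈ G, R (Formula.and γ φ) ψ} := by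
    refine ⟨hsub hG.prop.mem, fun ⟨γ, hγ, h⟩ => hcon γ hγ h,
      fun h ⟨γ, hγ, h'⟩ => ⟨γ, hγ, hR.trans h' h⟩, ?_⟩
    rintro ψ χ ⟨γ, hγ, h⟩ ⟨δ, hδ, h'⟩
    have hl := hL.ipc _ (.andLeft (Formula.and γ δ) φ)
    have hr := hL.ipc _ (.andRight (Formula.and γ δ) φ)
    exact ⟨Formula.and γ δ, hG.prop.and_mem hγ hδ, hR.and
      (hR.trans (hR.of_imp (hL.imp_and (hL.imp_trans hl (hL.ipc _ (.andLeft γ δ))) hr)) h)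
      (hR.trans (hR.of_imp (hL.imp_and (hL.imp_trans hl (hL.ipc _ (.andRight γ δ))) hr)) h')⟩
  exact hφ (hG.le_of_ge hfil hsub
    ⟨α, hG.prop.mem, hR.of_imp (hL.ipc _ (.andRight α φ))⟩)

/-- A prime filter theorem: if `α` does not entail `β`, some prime theory closed under the
entailment contains `α` and omits `β`. -/
theorem IsEntailment.exists_isPrimeTheory (hL : IsTheory L) (hR : IsEntailment L R)
    (h : ¬ R α β) : ∃ G, IsPrimeTheory L G ∧ α ∈ G ∧ β ∉ G ∧
      ∀ {φ ψ}, R φ ψ → φ ∈ G → ψ ∈ G := by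
  obtain ⟨G, hG⟩ := IsSeparatingFilter.exists_maximal hL hR h
  refine ⟨G, ⟨?_, ?_, ?_, ?_⟩, hG.prop.mem, hG.prop.notMem, hG.prop.up⟩
  · exact fun φ hφ => hG.prop.up (hR.of_imp (hL.imp_of_mem hφ)) hG.prop.mem
  · intro φ ψ h₁ h₂
    exact hG.prop.up (hR.of_imp (hL.imp_mp (hL.ipc _ (.andLeft (imp φ ψ) φ))
      (hL.ipc _ (.andRight (imp φ ψ) φ)))) (hG.prop.and_mem h₁ h₂)
  · exact fun hbot => hG.prop.notMem (hG.prop.up (hR.of_imp (hL.ipc _ (.exFalso β))) hbot)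
  · intro φ ψ hor
    by_contra! hcon
    obtain ⟨γ, hγ, h₁⟩ :=
      IsSeparatingFilter.exists_and_entails_of_maximal hL hR hG hcon.1
    obtain ⟨δ, hδ, h₂⟩ :=
      IsSeparatingFilter.exists_and_entails_of_maximal hL hR hG hcon.2
    -- Weakening both witnesses to `γ ∧ δ` lets distributivity and the join rule carry `(γ ∧ δ) ∧ (φ
    -- ∨ ψ)`, which lies in `G`, to `β`.
    have hl (χ : Formula Atom) := hL.ipc _ (.andLeft (Formula.and γ δ) χ)
    have hr (χ : Formula Atom) := hL.ipc _ (.andRight (Formula.and γ δ) χ)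
    have h₁' : R (Formula.and (Formula.and γ δ) φ) β := hR.trans (hR.of_imp
      (hL.imp_and (hL.imp_trans (hl φ) (hL.ipc _ (.andLeft γ δ))) (hr φ))) h₁
    have h₂' : R (Formula.and (Formula.and γ δ) ψ) β := hR.trans (hR.of_imp
      (hL.imp_and (hL.imp_trans (hl ψ) (hL.ipc _ (.andRight γ δ))) (hr ψ))) h₂
    exact hG.prop.notMem (hG.prop.up
      (hR.trans (hR.of_imp (hL.and_or_distrib (Formula.and γ δ) φ ψ)) (hR.or h₁' h₂'))
      (hG.prop.and_mem (hG.prop.and_mem hγ hδ) hor))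

end PrimeExtension

section Entailments

variable {L : Set (Formula Atom)}

theorem IsTheory.isEntailment_imp {T : Set (Formula Atom)} (hT : IsTheory T) (h : L ⊆ T) :
    IsEntailment L fun φ ψ => imp φ ψ ∈ T :=
  ⟨fun h' => h h', hT.imp_trans, hT.imp_and, hT.or_imp⟩

/-- The axioms `tr`, `ka` and `di` are the three closure conditions. Necessitation is needed only
for members of `L`, so `T` itself need not be closed under it. -/
theorem IsTheory.isEntailment_sto (hL : IsLogic L) {T : Set (Formula Atom)} (hT : IsTheory T)
    (h : L ⊆ T) : IsEntailment L fun φ ψ => sto φ ψ ∈ T :=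
  ⟨fun h' => h (hL.arrowNecessitation _ _ h'),
    fun h₁ h₂ => hT.mp (h (hL.arrow _ (.tr _ _ _))) (hT.and_mem h₁ h₂),
    fun h₁ h₂ => hT.mp (h (hL.arrow _ (.ka _ _ _))) (hT.and_mem h₁ h₂),
    fun h₁ h₂ => hT.mp (h (hL.arrow _ (.di _ _ _))) (hT.and_mem h₁ h₂)⟩

end Entailments

/-! ### The canonical frame and its truth lemma -/

/-- The canonical frame: prime theories ordered by inclusion. -/
def canonicalStoFrame (L : Set (Formula Atom)) : StoFrame.{u} where
  X := {G : Set (Formula Atom) // IsPrimeTheory L G}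
  r x y := ∀ φ ψ, sto φ ψ ∈ x.1 → φ ∈ y.1 → ψ ∈ y.1
  r_of_le_of_r _ _ _ hxy hyz φ ψ h := hyz φ ψ (Set.mem_of_subset_of_mem hxy h)

/-- The set of prime theories containing a formula. -/
def hat (L : Set (Formula Atom)) (φ : Formula Atom) : Set (canonicalStoFrame L).X :=
  {x | φ ∈ x.1}

section Hat

variable {L : Set (Formula Atom)}

theorem hat_top (hL : IsLogic L) : hat L top = Set.univ :=
  Set.eq_univ_of_forall fun x => x.2.subset (hL.ipc _ .top)

theorem hat_bot (L : Set (Formula Atom)) : hat L bot = ∅ :=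
  Set.eq_empty_of_forall_notMem fun x => x.2.bot_notMem

theorem hat_and (hL : IsLogic L) (φ ψ : Formula Atom) :
    hat L (Formula.and φ ψ) = hat L φ ∩ hat L ψ := by
  ext x
  have hx := x.2.isTheory hL.isTheory
  exact ⟨fun h => ⟨hx.and_left h, hx.and_right h⟩, fun h => hx.and_mem h.1 h.2⟩

theorem hat_or (hL : IsLogic L) (φ ψ : Formula Atom) :
    hat L (Formula.or φ ψ) = hat L φ ∪ hat L ψ := by
  ext x
  have hx := x.2.isTheory hL.isTheory
  exact ⟨x.2.mem_or_mem, fun h => h.elim (hx.mp (hx.ipc _ (.orLeft φ ψ)))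
    (hx.mp (hx.ipc _ (.orRight φ ψ)))⟩

theorem hat_imp (hL : IsLogic L) (φ ψ : Formula Atom) :
    hat L (imp φ ψ) = (canonicalStoFrame L).impSet (hat L φ) (hat L ψ) := by
  ext x
  have hx := x.2.isTheory hL.isTheory
  refine ⟨fun h y hxy hy => y.2.mp (hxy h) hy, fun h => ?_⟩
  by_contra hcon
  obtain ⟨G, hG, hφ, hψ, hup⟩ :=
    (hx.isEntailment_imp x.2.subset).exists_isPrimeTheory hL.isTheory hcon
  -- `G` extends `x`: each `χ` in `x` yields `φ → χ` in `x`, and `G` contains `φ`.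
  exact hψ (h ⟨G, hG⟩ (fun χ hχ => hup (hx.imp_of_mem hχ) hφ) hφ)

theorem hat_sto (hL : IsLogic L) (φ ψ : Formula Atom) :
    hat L (sto φ ψ) = (canonicalStoFrame L).stoSet (hat L φ) (hat L ψ) := by
  ext x
  have hx := x.2.isTheory hL.isTheory
  refine ⟨fun h y hxy hy => hxy φ ψ h hy, fun h => ?_⟩
  by_contra hcon
  obtain ⟨G, hG, hφ, hψ, hup⟩ :=
    (hx.isEntailment_sto hL x.2.subset).exists_isPrimeTheory hL.isTheory hcon
  -- Closure of `G` under the entailment is literally the relation `r` from `x` to `G`.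
  exact hψ (h ⟨G, hG⟩ (fun _ _ => hup) hφ)

theorem hat_eq_univ_iff (hL : IsLogic L) {φ : Formula Atom} :
    hat L φ = Set.univ ↔ φ ∈ L := by
  refine ⟨fun h => ?_, fun h => Set.eq_univ_of_forall fun x => x.2.subset h⟩
  by_contra hφ
  obtain ⟨G, hG, -, hG', -⟩ := (hL.isTheory.isEntailment_imp
    subset_rfl).exists_isPrimeTheory (α := top) (β := φ) hL.isTheory
    fun h' => hφ (hL.isTheory.mp h' (hL.ipc _ .top))
  exact hG' (Set.eq_univ_iff_forall.1 h ⟨G, hG⟩)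

/-- An admissible valuation amounts to a choice of formulas, that is, a substitution. The identity
substitution serves completeness, an arbitrary one serves soundness. -/
theorem truthSet_canonicalStoFrame (hL : IsLogic L) (s : Atom → Formula Atom)
    (φ : Formula Atom) :
    (canonicalStoFrame L).truthSet (fun p => hat L (s p)) φ = hat L (φ.subst s) := by
  induction φ with
  | atom p => rfl
  | top => exact (hat_top hL).symm
  | bot => exact (hat_bot L).symm
  | and φ ψ h₁ h₂ => simp only [StoFrame.truthSet, Formula.subst, hat_and hL, h₁, h₂]
  | or φ ψ h₁ h₂ => simp only [StoFrame.truthSet, Formula.subst, hat_or hL, h₁, h₂]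
  | imp φ ψ h₁ h₂ => simp only [StoFrame.truthSet, Formula.subst, hat_imp hL, h₁, h₂]
  | sto φ ψ h₁ h₂ => simp only [StoFrame.truthSet, Formula.subst, hat_sto hL, h₁, h₂]

end Hat

theorem Formula.subst_atom (φ : Formula Atom) : φ.subst atom = φ := by
  induction φ <;> simp_all [Formula.subst]

/-- The canonical general frame of a logic. -/
def canonicalFrame {L : Set (Formula Atom)} (hL : IsLogic L) : GeneralFrame.{u} where
  toStoFrame := canonicalStoFrame L
  P := Set.range (hat L)
  isUpperSet := by
    rintro _ ⟨φ, rfl⟩ x y hxy hx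
    exact hxy hx
  univ_mem := ⟨top, hat_top hL⟩
  empty_mem := ⟨bot, hat_bot L⟩
  inter_mem := by
    rintro _ ⟨φ, rfl⟩ _ ⟨ψ, rfl⟩
    exact ⟨_, hat_and hL φ ψ⟩
  union_mem := by
    rintro _ ⟨φ, rfl⟩ _ ⟨ψ, rfl⟩
    exact ⟨_, hat_or hL φ ψ⟩
  imp_mem := by
    rintro _ ⟨φ, rfl⟩ _ ⟨ψ, rfl⟩
    exact ⟨_, hat_imp hL φ ψ⟩
  sto_mem := by
    rintro _ ⟨φ, rfl⟩ _ ⟨ψ, rfl⟩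
    exact ⟨_, hat_sto hL φ ψ⟩

/-! ### Descriptiveness and characterisation -/

/-- Inclusion of truth sets relative to finitely many members of `S` is an entailment. -/
theorem isEntailment_sInter_inter_subset {L : Set (Formula Atom)} (hL : IsLogic L)
    (S : Set (Set (canonicalStoFrame L).X)) :
    IsEntailment L fun φ ψ => ∃ T ⊆ S, T.Finite ∧ ⋂₀ T ∩ hat L φ ⊆ hat L ψ := by
  refine ⟨fun h => ⟨∅, Set.empty_subset _, Set.finite_empty, fun x hx =>
    x.2.mp (x.2.subset h) hx.2⟩, ?_, ?_, ?_⟩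
  all_goals
    rintro φ ψ χ ⟨T, hT, hfin, h⟩ ⟨T', hT', hfin', h'⟩
    refine ⟨T ∪ T', Set.union_subset hT hT', hfin.union hfin', ?_⟩
    rw [Set.sInter_union]
  · exact fun x hx => h' ⟨hx.1.2, h ⟨hx.1.1, hx.2⟩⟩
  · rw [hat_and hL]
    exact fun x hx => ⟨h ⟨hx.1.1, hx.2⟩, h' ⟨hx.1.2, hx.2⟩⟩
  · rw [hat_or hL]
    exact fun x hx => hx.2.elim (fun hφ => h ⟨hx.1.1, hφ⟩) fun hψ => h' ⟨hx.1.2, hψ⟩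

theorem canonicalFrame_isDescriptive {L : Set (Formula Atom)} (hL : IsLogic L) :
    (canonicalFrame hL).IsDescriptive where
  compact := by
    intro A B hA hB hfip
    have hR := isEntailment_sInter_inter_subset hL (A ∪ B)
    -- The finite intersection property says exactly that `top` does not entail `bot` relative to `A
    -- ∪ B`.
    obtain ⟨G, hG, htop, -, hup⟩ := hR.exists_isPrimeTheory (α := top) (β := bot) hL.isTheory <| by
      rintro ⟨T, hT, hfin, h⟩
      obtain ⟨x, hx⟩ := hfip T hT hfin
      exact x.2.bot_notMem (h ⟨hx, x.2.subset (hL.ipc _ .top)⟩)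
    refine ⟨⟨G, hG⟩, ?_⟩
    rintro c (hc | hc)
    -- A singleton subfamily shows that `top` entails `φ` when `hat L φ` is in `A`, and that `φ`
    -- entails `bot` when its complement is in `B`.
    · obtain ⟨φ, rfl⟩ := hA hc
      exact hup ⟨{hat L φ}, Set.singleton_subset_iff.2 (Or.inl hc), Set.finite_singleton _,
        fun x hx => hx.1 _ rfl⟩ htop
    · obtain ⟨_, ⟨φ, rfl⟩, rfl⟩ := hB hc
      exact fun hφ => hG.bot_notMem (hup ⟨{(hat L φ)ᶜ}, Set.singleton_subset_iff.2 (Or.inr hc),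
        Set.finite_singleton _, fun x hx => (hx.1 _ rfl hx.2).elim⟩ hφ)
  leRefined := by
    intro x y hxy
    obtain ⟨φ, hx, hy⟩ := Set.not_subset.1 hxy
    exact ⟨hat L φ, ⟨φ, rfl⟩, hx, hy⟩
  rRefined := by
    intro x y hxy
    obtain ⟨φ, ψ, h, hφ, hψ⟩ : ∃ φ ψ, sto φ ψ ∈ x.1 ∧ φ ∈ y.1 ∧ ψ ∉ y.1 := by
      by_contra! hcon
      exact hxy hcon
    exact ⟨hat L φ, ⟨φ, rfl⟩, hat L ψ, ⟨ψ, rfl⟩, fun z hz => hz φ ψ h, hφ, hψ⟩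

theorem canonicalFrame_validates_iff {L : Set (Formula Atom)} (hL : IsLogic L)
    (φ : Formula Atom) : (canonicalFrame hL).Validates φ ↔ φ ∈ L := by
  constructor
  · intro h
    have h' := h (fun p => hat L (atom p)) fun p => ⟨_, rfl⟩
    rw [← hat_eq_univ_iff hL, ← Formula.subst_atom φ]
    exact (truthSet_canonicalStoFrame hL atom φ).symm.trans h'
  · intro h V hV
    -- Closure of `L` under substitution is what makes its members valid under every admissible
    -- valuation.
    choose s hs using hV
    obtain rfl : (fun p => hat L (s p)) = V := funext hs
    exact (truthSet_canonicalStoFrame hL s φ).trans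
      ((hat_eq_univ_iff hL).2 (hL.substitution s φ h))

end HeytingLewis

theorem mainTheorem8 {Atom : Type u} (L : Set (HeytingLewis.Formula Atom))
    (hL : HeytingLewis.IsLogic L) :
    ∃ C : Set HeytingLewis.GeneralFrame.{u},
      (∀ G ∈ C, G.IsDescriptive) ∧ HeytingLewis.IsCharacterisedBy L C := by
  refine ⟨{HeytingLewis.canonicalFrame hL}, ?_, fun φ => ?_⟩
  · rintro G rfl
    exact HeytingLewis.canonicalFrame_isDescriptive hL
  · rw [← HeytingLewis.canonicalFrame_validates_iff hL φ]
    simp
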